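/- All graphs are finite and simple. Both games below are played on a graph $G$ with full information. First the pursuers choose vertices (several pursuers may share a vertex), then the evader chooses a vertex; afterwards the pursuers and the evader move alternately, the pursuers first. On a turn, each piece of the side to move either stays where it is or moves to an adjacent vertex. The evader is *surrounded* if every neighbour of its vertex is occupied by a pursuer. In *Surrounding Cops and Robbers* the pursuers (cops) win if at some time they surround the evader (robber), or the robber's turn (or initial placement) ends on a vertex occupied by a cop; a cop may move onto the robber's vertex, and this does not end the game. The surrounding number $\sigma(G)$ is the least number of cops that have a winning strategy. In *Bodyguards and Presidents* the pursuers (bodyguards) win if they surround the evader (president) at the end of all but finitely many bodyguard turns. The bodyguard number $B(G)$ is the least number of bodyguards that have a winning strategy. The strong product $G\boxtimes H$ has vertex set $V(G)\times V(H)$, and $(u,v)$, $(x,y)$ are adjacent if $ux\in E(G)$ and $v=y$, or $u=x$ and $vy\in E(H)$, or $ux\in E(G)$ and $vy\in E(H)$. **Theorem.** If $G$ and $H$ are finite connected graphs, then $$\sigma(G\boxtimes H)\le \min\{\sigma(H)\,(B(G)+1)+\sigma(G),\ \sigma(G)\,(B(H)+1)+\sigma(H)\}.$$ The bound is tight: for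 $3\le n\le 5$ and $m\ge 3$, equality holds for $G=C_n$ and $H=C_m$, and $\sigma(C_n\boxtimes C_m)=8$. -/

import Mathlib

namespace PursuitGames

/-- The strong product `G ⊠ H`. -/
def strongProd {V W : Type*} (G : SimpleGraph V) (H : SimpleGraph W) : SimpleGraph (V × W) where
  Adj x y :=
    (G.Adj x.1 y.1 ∧ x.2 = y.2) ∨ (x.1 = y.1 ∧ H.Adj x.2 y.2) ∨ (G.Adj x.1 y.1 ∧ H.Adj x.2 y.2)
  symm := ⟨by
    rintro x y (⟨h, e⟩ | ⟨e, h⟩ | ⟨h, h'⟩)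
    · exact Or.inl ⟨h.symm, e.symm⟩
    · exact Or.inr (Or.inl ⟨e.symm, h.symm⟩)
    · exact Or.inr (Or.inr ⟨h.symm, h'.symm⟩)⟩
  loopless := ⟨by
    rintro x (⟨h, -⟩ | ⟨-, h⟩ | ⟨h, -⟩)
    · exact G.loopless.irrefl _ h
    · exact H.loopless.irrefl _ h
    · exact G.loopless.irrefl _ h⟩

variable {V : Type*}

/-- A legal move of one piece: stay, or move along an edge. -/
def Step (G : SimpleGraph V) (u v : V) : Prop := u = v ∨ G.Adj u v

/-- A sequence of positions of the evader (robber or president): `r 0` is the vertex chosen at the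
start, and every later position arises from the preceding one by a legal move. -/
def IsPlay (G : SimpleGraph V) (r : ℕ → V) : Prop := ∀ t, Step G (r t) (r (t + 1))

/-- A strategy for `k` pursuers (cops or bodyguards) with perfect information. The list is the
sequence of all positions of the evader so far, latest first. `pos []` is the placement of the
pursuers at the start, before the evader chooses a vertex, and `pos (v :: h)` are their positions
after they answer the evader's arrival at `v`. Several pursuers may share a vertex. -/
structure Strategy (G : SimpleGraph V) (k : ℕ) where
  pos : List V → Fin k → V
  legal : ∀ (h : List V) (v : V) (i : Fin k), Step G (pos h i) (pos (v :: h) i)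

/-- The positions `r 0, …, r (t - 1)`, latest first. -/
def history (r : ℕ → V) : ℕ → List V
  | 0 => []
  | t + 1 => r t :: history r t

/-- The positions of the pursuers after `t` of their turns, when they follow the strategy `S`
against the evader's moves `r`. -/
def Strategy.posAt {G : SimpleGraph V} {k : ℕ} (S : Strategy G k) (r : ℕ → V) (t : ℕ) : Fin k → V :=
  S.pos (history r t)

/-- Some pursuer is on the vertex `v`. -/
def Occupied {k : ℕ} (c : Fin k → V) (v : V) : Prop := ∃ i, c i = v

/-- Every neighbour of `v` is occupied by a pursuer. -/
def Surrounded (G : SimpleGraph V) {k : ℕ} (c : Fin k → V) (v : V) : Prop :=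
  ∀ w, G.Adj v w → Occupied c w

/-- `k` cops win Surrounding Cops and Robbers on `G`: they have a strategy such that, however the
robber plays, at some time `t` either the robber ends his turn (or is placed) on a vertex occupied
by a cop, or he is surrounded at the end of the cops' next turn. A cop may move onto the robber's
vertex, which does not end the game. -/
def SurroundingCopsWin (G : SimpleGraph V) (k : ℕ) : Prop :=
  ∃ S : Strategy G k, ∀ r : ℕ → V, IsPlay G r →
    ∃ t, Occupied (S.posAt r t) (r t) ∨ Surrounded G (S.posAt r (t + 1)) (r t)

/-- `k` bodyguards win Bodyguards and Presidents on `G`: they have a strategy such that, however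
the president plays, he is surrounded at the end of all but finitely many bodyguard turns. -/
def BodyguardsWin (G : SimpleGraph V) (k : ℕ) : Prop :=
  ∃ S : Strategy G k, ∀ p : ℕ → V, IsPlay G p →
    ∃ N, ∀ t, N ≤ t → Surrounded G (S.posAt p (t + 1)) (p t)

/-- The surrounding number `σ(G)`: the least number of cops that win. -/
noncomputable def surroundingNumber (G : SimpleGraph V) : ℕ := sInf {k | SurroundingCopsWin G k}

/-- The bodyguard number `B(G)`: the least number of bodyguards that win. -/
noncomputable def bodyguardNumber (G : SimpleGraph V) : ℕ := sInf {k | BodyguardsWin G k}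

/-- On a finite graph the minimum defining `B(G)` is attained. -/
theorem bodyguardsWin_bodyguardNumber [Finite V] (G : SimpleGraph V) :
    BodyguardsWin G (bodyguardNumber G) := by
  refine Nat.sInf_mem (s := {k | BodyguardsWin G k}) ⟨Nat.card V, ?_⟩
  refine ⟨⟨fun _ => (Finite.equivFin V).symm, fun _ _ _ => Or.inl rfl⟩, fun p _ => ⟨0, ?_⟩⟩
  exact fun t _ w _ => ⟨Finite.equivFin V w, (Finite.equivFin V).symm_apply_apply w⟩

/-- On a finite graph the minimum defining `σ(G)` is attained. -/
theorem surroundingCopsWin_surroundingNumber [Finite V] (G : SimpleGraph V) :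
    SurroundingCopsWin G (surroundingNumber G) := by
  refine Nat.sInf_mem (s := {k | SurroundingCopsWin G k}) ⟨Nat.card V, ?_⟩
  refine ⟨⟨fun _ => (Finite.equivFin V).symm, fun _ _ _ => Or.inl rfl⟩, fun r _ => ⟨0, Or.inl ?_⟩⟩
  exact ⟨Finite.equivFin V (r 0), (Finite.equivFin V).symm_apply_apply (r 0)⟩

end PursuitGames

namespace PursuitGames

/-! ### Forced wins as an inductive predicate, and their equivalence with strategies. -/

section Force

variable {V W ι κ : Type*} {G : SimpleGraph V} {H : SimpleGraph W}

/-! For the bound, the cops form σ(H) groups of B(G) bodyguards each, plus σ(H) + σ(G) free cops.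
The groups guard the robber's first coordinate, each group staying in a common layer (a fixed second
coordinate). Once a group also has a shadow, a free cop repeating that coordinate in the group's
layer, it covers the closed neighbourhood of the coordinate there. A robber whose move ends in that
layer is then caught, so the group acts like one cop on H.

The shadows are won one at a time, by σ(G) free cops playing on first coordinates
(`groupForce_add_shadow`). The groups then win on H: they catch the robber or fence in his layer
(`groupForce_layer_game`). In the fenced layer the σ(G) remaining cops play their game on G
(`groupForce_trapped`); when it ends in a surround, they fill the neighbours inside the layer, the
shadows and bodyguards all others. The bodyguards may fail finitely often; `bodyguard_induction`
absorbs this.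

For cycles, the lower bound 8 is the degree of the product, and two bodyguards win on cycles of
length at most 5. -/

theorem Step.refl (v : V) : Step G v v := Or.inl rfl

/-- The cops, at positions `c` and to move, can force a win in finitely many turns against the
robber at `v`. -/
inductive CopsForce (G : SimpleGraph V) : (ι → V) → V → Prop
  | captured {c : ι → V} {v : V} (i : ι) : c i = v → CopsForce G c v
  | surround {c : ι → V} {v : V} (c' : ι → V) : (∀ i, Step G (c i) (c' i)) →
      (∀ w, G.Adj v w → ∃ i, c' i = w) → CopsForce G c v
  | move {c : ι → V} {v : V} (c' : ι → V) : (∀ i, Step G (c i) (c' i)) →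
      (∀ v', Step G v v' → CopsForce G c' v') → CopsForce G c v

theorem CopsForce.map (φ : G ≃g H) (e : κ ≃ ι) {c : ι → V} {v : V} (h : CopsForce G c v) :
    CopsForce H (fun j => φ (c (e j))) (φ v) := by
  have hs : ∀ {x y}, Step G x y → Step H (φ x) (φ y) := fun h =>
    h.elim (fun e => Or.inl (congrArg φ e)) (fun e => Or.inr (φ.map_adj_iff.2 e))
  induction h with
  | captured i hi => exact .captured (e.symm i) (by simp [hi])
  | surround c' hc hw =>
    refine .surround (fun j => φ (c' (e j))) (fun j => hs (hc _)) fun w hvw => ?_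
    obtain ⟨i, hi⟩ := hw (φ.symm w) (φ.map_adj_iff.1 (by simpa using hvw))
    exact ⟨e.symm i, by simp [hi]⟩
  | @move c v c' hc _ ih =>
    refine .move (fun j => φ (c' (e j))) (fun j => hs (hc _)) fun w hvw => ?_
    have : Step G v (φ.symm w) := hvw.elim (fun e => Or.inl (by simp [← e]))
      (fun e => Or.inr (φ.map_adj_iff.1 (by simpa using e)))
    simpa using ih _ this

theorem CopsForce.reindex (e : κ ≃ ι) {c : ι → V} {v : V} (h : CopsForce G c v) :
    CopsForce G (fun j => c (e j)) v := by
  simpa using h.map (SimpleGraph.Iso.refl (G := G)) e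

theorem history_succ (r : ℕ → V) (t : ℕ) :
    history r (t + 1) = history (fun s => r (s + 1)) t ++ [r 0] := by
  induction t with
  | zero => rfl
  | succ t ih => rw [history, ih]; rfl

/-- The strategy that plays `S v` against an evader who starts at `v`, when all of the `S v` have
the same placement at the start. -/
def Strategy.choose {k : ℕ} (c : Fin k → V) (S : V → Strategy G k)
    (hS : ∀ v, (S v).pos [] = c) : Strategy G k where
  pos
    | [] => c
    -- Histories list the latest position first, so `getLast` is the evader's initial vertex.
    | v :: h => (S ((v :: h).getLast (List.cons_ne_nil _ _))).pos (v :: h)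
  legal h v i := by
    cases h with
    | nil => simpa [hS] using (S v).legal [] v i
    | cons u h => simpa using (S ((u :: h).getLast (List.cons_ne_nil _ _))).legal (u :: h) v i

theorem Strategy.choose_posAt {k : ℕ} (c : Fin k → V) (S : V → Strategy G k)
    (hS : ∀ v, (S v).pos [] = c) (r : ℕ → V) (t : ℕ) :
    (Strategy.choose c S hS).posAt r t = (S (r 0)).posAt r t := by
  cases t with
  | zero => exact (hS _).symm
  | succ t =>
    have : ∀ h ne, h = history r (t + 1) → h.getLast ne = r 0 := by
      rintro h ne rfl
      simp [history_succ]
    simp only [Strategy.posAt]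
    exact congrArg (fun u => (S u).pos (r t :: history r t)) (this _ (List.cons_ne_nil _ _) rfl)

/-- The strategy that starts at `c` and from the first turn on plays `S`, which starts within one
step of `c`. -/
def Strategy.delay {k : ℕ} (c : Fin k → V) (S : Strategy G k)
    (hS : ∀ i, Step G (c i) (S.pos [] i)) : Strategy G k where
  pos
    | [] => c
    | v :: h => S.pos (v :: h).dropLast
  legal h v i := by
    cases h with
    | nil => exact hS i
    | cons u h => simpa using S.legal (u :: h).dropLast v i

theorem Strategy.delay_posAt_succ {k : ℕ} (c : Fin k → V) (S : Strategy G k)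
    (hS : ∀ i, Step G (c i) (S.pos [] i)) (r : ℕ → V) (t : ℕ) :
    (Strategy.delay c S hS).posAt r (t + 1) = S.posAt (fun s => r (s + 1)) t := by
  change S.pos (history r (t + 1)).dropLast = _
  rw [history_succ, List.dropLast_concat]
  rfl

/-- After the first turn, the strategies for the robber's possible replies are glued by `choose`,
and `delay` puts that turn in front. -/
theorem CopsForce.exists_strategy {k : ℕ} {c : Fin k → V} {v : V} (h : CopsForce G c v) :
    ∃ S : Strategy G k, S.pos [] = c ∧ ∀ r : ℕ → V, IsPlay G r → r 0 = v →
      ∃ t, Occupied (S.posAt r t) (r t) ∨ Surrounded G (S.posAt r (t + 1)) (r t) := by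
  induction h with
  | @captured c v i hi =>
    exact ⟨⟨fun _ => c, fun _ _ _ => .refl _⟩, rfl, fun r _ h0 => ⟨0, Or.inl ⟨i, hi.trans h0.symm⟩⟩⟩
  | @surround c v c' hc hw =>
    refine ⟨.delay c ⟨fun _ => c', fun _ _ _ => .refl _⟩ hc, rfl,
      fun r _ h0 => ⟨0, Or.inr ?_⟩⟩
    rw [Strategy.delay_posAt_succ, h0]
    exact hw
  | @move c v c' hc _ ih =>
    have : ∀ v', ∃ S : Strategy G k, S.pos [] = c' ∧ (Step G v v' → ∀ r : ℕ → V, IsPlay G r →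
        r 0 = v' → ∃ t, Occupied (S.posAt r t) (r t) ∨ Surrounded G (S.posAt r (t + 1)) (r t)) := by
      intro v'
      by_cases hv : Step G v v'
      · obtain ⟨S, h1, h2⟩ := ih v' hv
        exact ⟨S, h1, fun _ => h2⟩
      · exact ⟨⟨fun _ => c', fun _ _ _ => .refl _⟩, rfl, fun h => absurd h hv⟩
    choose S hS hwin using this
    have hc' : ∀ i, Step G (c i) ((Strategy.choose c' S hS).pos [] i) := hc
    refine ⟨.delay c (.choose c' S hS) hc', rfl, fun r hr h0 => ?_⟩
    obtain ⟨t, ht⟩ := hwin (r 1) (h0 ▸ hr 0) (fun s => r (s + 1)) (fun s => hr (s + 1)) rfl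
    refine ⟨t + 1, ?_⟩
    rw [Strategy.delay_posAt_succ, Strategy.delay_posAt_succ, Strategy.choose_posAt,
      Strategy.choose_posAt]
    exact ht

/-- From a position that is not forced, every cop move leaves the robber a reply that is again not
forced; iterating such replies gives a play that defeats the strategy. -/
theorem surroundingCopsWin_iff {k : ℕ} :
    SurroundingCopsWin G k ↔ ∃ c : Fin k → V, ∀ v, CopsForce G c v := by
  constructor
  · rintro ⟨S, hS⟩
    refine ⟨S.pos [], fun v => ?_⟩
    by_contra hv
    have hnext : ∀ x : {x : List V × V // ¬ CopsForce G (S.pos x.1) x.2}, ∃ v', Step G x.1.2 v' ∧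
        ¬ CopsForce G (S.pos (x.1.2 :: x.1.1)) v' := by
      rintro ⟨⟨h, v⟩, hx⟩
      by_contra! hcon
      exact hx (.move _ (S.legal h v) hcon)
    choose nx hstep hnot using hnext
    let s : ℕ → {x : List V × V // ¬ CopsForce G (S.pos x.1) x.2} := fun t =>
      Nat.rec ⟨([], v), hv⟩ (fun _ x => ⟨(x.1.2 :: x.1.1, nx x), hnot x⟩) t
    have hhist : ∀ t, history (fun t => (s t).1.2) t = (s t).1.1 := by
      intro t
      induction t with
      | zero => rfl
      | succ t ih => rw [history, ih]
    obtain ⟨t, ht⟩ := hS (fun t => (s t).1.2) (fun t => hstep (s t))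
    simp only [Strategy.posAt, history, hhist] at ht
    rcases ht with ⟨i, hi⟩ | ht
    · exact (s t).2 (.captured i hi)
    · exact (s t).2 (.surround _ (S.legal _ _) ht)
  · rintro ⟨c, hc⟩
    choose S hS hwin using fun v => (hc v).exists_strategy
    refine ⟨.choose c S hS, fun r hr => ?_⟩
    simp only [Strategy.choose_posAt]
    exact hwin (r 0) r hr rfl

theorem surroundingNumber_le_of_copsForce [Fintype ι] {k : ℕ} (hk : Fintype.card ι = k)
    (c : ι → V) (h : ∀ v, CopsForce G c v) : surroundingNumber G ≤ k :=
  Nat.sInf_le (surroundingCopsWin_iff.2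
    ⟨_, fun v => (h v).reindex (Fintype.equivFinOfCardEq hk).symm⟩)

theorem surroundingNumber_le_of_iso [Finite V] (φ : G ≃g H) :
    surroundingNumber H ≤ surroundingNumber G := by
  obtain ⟨c, hc⟩ := surroundingCopsWin_iff.1 (surroundingCopsWin_surroundingNumber G)
  refine surroundingNumber_le_of_copsForce (Fintype.card_fin _) (fun i => φ (c i)) fun v => ?_
  simpa using (hc (φ.symm v)).map φ (Equiv.refl _)

/-! ### Lower bounds from the minimum degree. -/

/-- Every closed neighbourhood has more than `d` vertices. -/
def MinDegreeGE (G : SimpleGraph V) (d : ℕ) : Prop :=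
  ∀ v, ∃ N : Finset V, d + 1 ≤ N.card ∧ v ∈ N ∧ ∀ w ∈ N, Step G v w

theorem exists_notMem_range {k : ℕ} (c : Fin k → V) {N : Finset V} (hN : k < N.card) :
    ∃ w ∈ N, ∀ i, c i ≠ w := by
  classical
  obtain ⟨w, hw, hwc⟩ := Finset.exists_mem_notMem_of_card_lt_card
    (s := Finset.univ.image c) (t := N)
    (lt_of_le_of_lt Finset.card_image_le (by simpa using hN))
  exact ⟨w, hw, fun i hi => hwc (Finset.mem_image.2 ⟨i, Finset.mem_univ _, hi⟩)⟩

theorem MinDegreeGE.le_of_surrounded {d k : ℕ} (hd : MinDegreeGE G d) {c : Fin k → V} {v : V}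
    (h : ∀ w, G.Adj v w → ∃ i, c i = w) : d ≤ k := by
  classical
  by_contra! hk
  obtain ⟨N, hN, hv, hs⟩ := hd v
  obtain ⟨w, hw, hwc⟩ := exists_notMem_range c (N := N.erase v)
    (by rw [Finset.card_erase_of_mem hv]; omega)
  obtain ⟨hwv, hw⟩ := Finset.mem_erase.1 hw
  obtain ⟨i, hi⟩ := h w ((hs w hw).resolve_left fun e => hwv e.symm)
  exact hwc i hi

/-- Fewer than `d` cops never surround, and they always leave free a vertex of the robber's closed
neighbourhood. A win is thus forced only where the robber is already caught. -/
theorem MinDegreeGE.le_surroundingNumber [Finite V] [Nonempty V] {d : ℕ} (hd : MinDegreeGE G d) :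
    d ≤ surroundingNumber G := by
  obtain ⟨c, hc⟩ := surroundingCopsWin_iff.1 (surroundingCopsWin_surroundingNumber G)
  by_contra! hk
  have key : ∀ (c : Fin (surroundingNumber G) → V) v, CopsForce G c v → ∃ i, c i = v := by
    intro c v h
    induction h with
    | captured i hi => exact ⟨i, hi⟩
    | surround c' _ hw => exact absurd (hd.le_of_surrounded hw) (by omega)
    | @move c v c' _ _ ih =>
      obtain ⟨N, hN, hv, hs⟩ := hd v
      obtain ⟨w, hw, hwc⟩ := exists_notMem_range c' (N := N) (by omega)
      obtain ⟨i, hi⟩ := ih w (hs w hw)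
      exact absurd hi (hwc i)
  obtain ⟨N, hN, -⟩ := hd (Classical.arbitrary V)
  obtain ⟨w, -, hwc⟩ := exists_notMem_range c (N := N) (by omega)
  obtain ⟨i, hi⟩ := key c w (hc w)
  exact hwc i hi

theorem MinDegreeGE.le_bodyguardNumber [Finite V] [Nonempty V] {d : ℕ} (hd : MinDegreeGE G d) :
    d ≤ bodyguardNumber G := by
  obtain ⟨S, hS⟩ := bodyguardsWin_bodyguardNumber G
  obtain ⟨N, hN⟩ := hS (fun _ => Classical.arbitrary V) (fun _ => .refl _)
  exact hd.le_of_surrounded (hN N le_rfl)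

end Force

/-! ### Induction along a winning strategy of the bodyguards. -/

section History

variable {V : Type*} {G : SimpleGraph V}

/-- A nonempty sequence of legal positions of the evader, latest first. -/
def IsHistory (G : SimpleGraph V) (h : List V) : Prop :=
  h ≠ [] ∧ h.IsChain (fun a b => Step G b a)

theorem IsHistory.suffix {h h' : List V} (hh : IsHistory G h) (hs : h' <:+ h) (hne : h' ≠ []) :
    IsHistory G h' :=
  ⟨hne, hh.2.suffix hs⟩

theorem IsHistory.cons {h : List V} {u v : V} (hh : IsHistory G (u :: h)) (hv : Step G u v) :
    IsHistory G (v :: u :: h) :=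
  ⟨List.cons_ne_nil _ _, List.isChain_cons_cons.2 ⟨hv, hh.2⟩⟩

theorem getElem?_reverse_of_suffix {l l' : List V} (hs : l <:+ l') {n : ℕ} (hn : n < l.length) :
    l'.reverse[n]? = l.reverse[n]? := by
  obtain ⟨t, rfl⟩ := hs
  rw [List.reverse_append, List.getElem?_append_left (by simpa using hn)]

/-- A growing sequence of histories is the sequence of histories of one infinite play. -/
theorem exists_play_of_histories {s : ℕ → List V} (hs : ∀ t, IsHistory G (s t))
    (hlt : ∀ t, s t <:+ s (t + 1)) (hlen : ∀ t, t < (s t).length) :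
    ∃ p : ℕ → V, IsPlay G p ∧ ∀ t, history p (s t).length = s t := by
  have hmono : ∀ i j, i ≤ j → s i <:+ s j := fun i j hij =>
    Nat.le_induction (List.suffix_refl _) (fun j _ ih => ih.trans (hlt j)) j hij
  -- Reversal puts the oldest position first; since `s t` has more than `t` entries, its entry `t`
  -- is final.
  let p : ℕ → V := fun t => (s t).reverse[t]'(by simpa using hlen t)
  have hp : ∀ l j, l <:+ s j → history p l.length = l := by
    intro l
    induction l with
    | nil => intros; rfl
    | cons a l ih =>
      intro j hj
      rw [List.length_cons, history, ih j ((List.suffix_cons _ _).trans hj)]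
      congr 1
      have h1 : (s j).reverse[l.length]? = some a := by
        rw [getElem?_reverse_of_suffix hj (by simp)]
        simp
      have h2 : (s l.length).reverse[l.length]? = some (p l.length) :=
        List.getElem?_eq_getElem _
      have hl : l.length < (s j).length := by simpa using hj.length_le
      rcases le_total l.length j with h | h
      · rw [getElem?_reverse_of_suffix (hmono _ _ h) (hlen _), h2] at h1
        exact Option.some.inj h1
      · rw [getElem?_reverse_of_suffix (hmono _ _ h) hl, h1] at h2
        exact (Option.some.inj h2).symm
  refine ⟨p, fun t => ?_, fun t => hp _ t (List.suffix_refl _)⟩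
  have hlen' := hlen (t + 1)
  have hd : history p (t + 2) = (s (t + 1)).drop ((s (t + 1)).length - (t + 2)) := by
    have h := hp _ (t + 1) (List.drop_suffix ((s (t + 1)).length - (t + 2)) (s (t + 1)))
    rwa [List.length_drop, Nat.sub_sub_self (by omega)] at h
  have hh : IsHistory G (history p (t + 2)) := by
    refine (hs (t + 1)).suffix ?_ (List.cons_ne_nil _ _)
    rw [hd]
    exact List.drop_suffix _ _
  exact (List.isChain_cons_cons.1 hh.2).1

/-- Induction on histories along a winning strategy of the bodyguards: it may be assumed that the
claim holds for all later histories after which the president is not surrounded. -/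
theorem bodyguard_induction {k : ℕ} {S : Strategy G k}
    (hS : ∀ p : ℕ → V, IsPlay G p → ∃ N, ∀ t, N ≤ t → Surrounded G (S.posAt p (t + 1)) (p t))
    {Q : List V → Prop}
    (hQ : ∀ h, IsHistory G h → (∀ v h', h <:+ h' → IsHistory G (v :: h') →
      Surrounded G (S.pos (v :: h')) v ∨ Q (v :: h')) → Q h)
    (h : List V) (hh : IsHistory G h) : Q h := by
  -- Otherwise failing histories extend each other forever, and their limit is a play in which the
  -- president escapes infinitely often.
  by_contra hnot
  have hnext : ∀ x : {h : List V // IsHistory G h ∧ ¬ Q h}, ∃ v h', x.1 <:+ h' ∧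
      IsHistory G (v :: h') ∧ ¬ Surrounded G (S.pos (v :: h')) v ∧ ¬ Q (v :: h') := by
    rintro ⟨h, hh, hn⟩
    by_contra! hcon
    exact hn (hQ h hh fun v h' h1 h2 => or_iff_not_imp_left.2 (hcon v h' h1 h2))
  choose nv nh hsuf hhist hsur hnQ using hnext
  let s : ℕ → {h : List V // IsHistory G h ∧ ¬ Q h} := fun t =>
    Nat.rec ⟨h, hh, hnot⟩ (fun _ x => ⟨nv x :: nh x, hhist x, hnQ x⟩) t
  have hlt : ∀ t, (s t).1 <:+ (s (t + 1)).1 := fun t => (hsuf (s t)).trans (List.suffix_cons _ _)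
  have hlen : ∀ t, t < (s t).1.length := by
    intro t
    induction t with
    | zero => exact List.length_pos_iff.2 hh.1
    | succ t ih =>
      have := (hsuf (s t)).length_le
      change t + 1 < (nv (s t) :: nh (s t)).length
      rw [List.length_cons]
      omega
  obtain ⟨p, hp, hps⟩ := exists_play_of_histories (fun t => (s t).2.1) hlt hlen
  obtain ⟨N, hN⟩ := hS p hp
  have h1 : history p ((nh (s N)).length + 1) = nv (s N) :: nh (s N) := hps (N + 1)
  have h2 := hN (nh (s N)).length
    (by have := hlen N; have := (hsuf (s N)).length_le; omega)
  rw [Strategy.posAt, h1] at h2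
  rw [history] at h1
  rw [(List.cons.inj h1).1] at h2
  exact hsur _ h2

end History

/-! ### The upper bound for the strong product. -/

section Product

variable {V W κ τ : Type*} {b : ℕ} {G : SimpleGraph V} {H : SimpleGraph W}

theorem step_strongProd {x y : V × W} :
    Step (strongProd G H) x y ↔ Step G x.1 y.1 ∧ Step H x.2 y.2 := by
  simp only [Step, strongProd, Prod.ext_iff]
  tauto

theorem exists_step_dist_le (hG : G.Connected) {n : ℕ} {a c : V} (h : G.dist a c ≤ n + 1) :
    ∃ a', Step G a a' ∧ G.dist a' c ≤ n := by
  obtain ⟨p, hp⟩ := hG.exists_walk_length_eq_dist a c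
  cases p with
  | nil => exact ⟨a, .refl a, by simp⟩
  | cons hadj q =>
    refine ⟨_, Or.inr hadj, (SimpleGraph.dist_le q).trans ?_⟩
    rw [SimpleGraph.Walk.length_cons] at hp
    omega

theorem exists_adj_of_connected [Nontrivial V] (hG : G.Connected) (a : V) : ∃ x, G.Adj a x := by
  obtain ⟨c, hc⟩ := exists_ne a
  obtain ⟨p⟩ := hG.preconnected a c
  cases p with
  | nil => exact absurd rfl hc
  | cons hadj _ => exact ⟨_, hadj⟩

theorem exists_forall_le [Finite τ] (g : τ → ℕ) : ∃ n, ∀ i, g i ≤ n := by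
  obtain ⟨n, hn⟩ := (Set.finite_range g).bddAbove
  exact ⟨n, fun i => hn ⟨i, rfl⟩⟩

/-- Positions in `G ⊠ H` of the cops: for each `i`, a group of bodyguards that play `S` in the
first coordinate and share the second coordinate `y i`; and further cops at `f`. -/
def config (S : Strategy G b) (h : List V) (y : κ → W) (f : τ → V × W) :
    (κ × Fin b) ⊕ τ → V × W :=
  Sum.elim (fun x => (S.pos h x.2, y x.1)) f

theorem config_step (S : Strategy G b) (h : List V) (v : V) {y y' : κ → W} {f f' : τ → V × W}
    (hy : ∀ i, Step H (y i) (y' i)) (hf : ∀ i, Step (strongProd G H) (f i) (f' i)) (i) :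
    Step (strongProd G H) (config S h y f i) (config S (v :: h) y' f' i) := by
  rcases i with ⟨i, j⟩ | i
  · exact step_strongProd.2 ⟨S.legal h v j, hy i⟩
  · exact hf i

/-- After every later history, the bodyguards surround the president or the cops win. -/
def Settled (H : SimpleGraph W) (κ τ : Type*) (S : Strategy G b) (h : List V) : Prop :=
  ∀ v h', h <:+ h' → IsHistory G (v :: h') → Surrounded G (S.pos (v :: h')) v ∨
    ∀ (y : κ → W) (f : τ → V × W) (w : V × W), Step G v w.1 →
      CopsForce (strongProd G H) (config S (v :: h') y f) w

/-- The cops can force a win against the robber at `v` whose first coordinate has just moved away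
from `u`, if the bodyguards surround `u` and the history is settled. -/
def GroupForce (H : SimpleGraph W) (S : Strategy G b) (y : κ → W) (f : τ → V × W) (u : V)
    (v : V × W) : Prop :=
  Step G u v.1 → ∀ h, Settled H κ τ S (u :: h) → IsHistory G (u :: h) →
    Surrounded G (S.pos (u :: h)) u → CopsForce (strongProd G H) (config S (u :: h) y f) v

variable {S : Strategy G b} {y y' : κ → W} {f f' : τ → V × W} {u : V} {v : V × W}

theorem Settled.mono {h h' : List V} (hs : Settled H κ τ S h) (hh : h <:+ h') :
    Settled H κ τ S h' :=
  fun v h'' h1 h2 => hs v h'' (hh.trans h1) h2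

theorem GroupForce.of_step (h : Step G u v.1 → GroupForce H S y f u v) : GroupForce H S y f u v :=
  fun hu => h hu hu

/-- If the bodyguards' answer fails to surround, `Settled` already gives a win, so only the
surrounded case has to be continued. -/
theorem GroupForce.move (y' : κ → W) (f' : τ → V × W) (hy : ∀ i, Step H (y i) (y' i))
    (hf : ∀ i, Step (strongProd G H) (f i) (f' i))
    (hnext : ∀ v', Step G v.1 v'.1 → Step H v.2 v'.2 → GroupForce H S y' f' v.1 v') :
    GroupForce H S y f u v := by
  intro huv h hset hh _
  refine .move _ (config_step S (u :: h) v.1 hy hf) fun v' hv' => ?_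
  obtain ⟨h1, h2⟩ := step_strongProd.1 hv'
  rcases hset v.1 (u :: h) (List.suffix_refl _) (hh.cons huv) with hs | hw
  · exact hnext v' h1 h2 h1 _ (hset.mono (List.suffix_cons _ _)) (hh.cons huv) hs
  · exact hw y' f' v' h1

theorem GroupForce.surround (y' : κ → W) (f' : τ → V × W) (hy : ∀ i, Step H (y i) (y' i))
    (hf : ∀ i, Step (strongProd G H) (f i) (f' i))
    (hsur : ∀ x : V × W, (strongProd G H).Adj v x →
      (G.Adj v.1 x.1 ∧ ∃ i, y' i = x.2) ∨ ∃ i, f' i = x) :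
    GroupForce H S y f u v := by
  intro huv h hset hh _
  rcases hset v.1 (u :: h) (List.suffix_refl _) (hh.cons huv) with hs | hw
  · refine .surround _ (config_step S (u :: h) v.1 hy hf) fun x hx => ?_
    rcases hsur x hx with ⟨h1, i, hi⟩ | ⟨i, hi⟩
    · obtain ⟨j, hj⟩ := hs _ h1
      exact ⟨Sum.inl (i, j), Prod.ext hj hi⟩
    · exact ⟨Sum.inr i, hi⟩
  · refine .move _ (config_step S (u :: h) v.1 hy hf) fun v' hv' => ?_
    exact hw y' f' v' (step_strongProd.1 hv').1

theorem GroupForce.captured (i : τ) (hi : f i = v) : GroupForce H S y f u v :=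
  fun _ _ _ _ _ => .captured (Sum.inr i) hi

/-- The shadow catches a robber who kept his first coordinate, a bodyguard one who changed it. -/
theorem GroupForce.captured_group (i : κ) (j : τ) (hj : f j = (u, y i)) (hi : y i = v.2) :
    GroupForce H S y f u v := by
  rintro (huv | huv) h _ _ hs
  · exact .captured (Sum.inr j) (hj.trans (Prod.ext huv hi))
  · obtain ⟨l, hl⟩ := hs _ huv
    exact .captured (Sum.inl (i, l)) (Prod.ext hl hi)

theorem GroupForce.reindex (e : Equiv.Perm τ) (h : GroupForce H S y (f ∘ e) u v) :
    GroupForce H S y f u v := by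
  intro huv l hset hh hs
  have h1 := (h huv l hset hh hs).reindex (Equiv.sumCongr (Equiv.refl (κ × Fin b)) e.symm)
  convert h1 using 1
  ext i : 1
  rcases i with i | i <;> simp [config]

section Trapped

/-! The robber cannot leave the layer of `z` any more. -/

variable {f : κ ⊕ τ → V × W}

/-- The groups occupy all layers adjacent to that of `z`, so leaving it means capture; meanwhile the
cops of `τ` play on `G` inside the layer. -/
theorem groupForce_trapped_game {z : W} (hy : ∀ w, H.Adj z w → ∃ i, y i = w) {c : τ → V} {g : V}
    (hc : CopsForce G c g) (hg : v.1 = g) (hz : Step H z v.2)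
    (hsh : ∀ i, f (Sum.inl i) = (u, y i)) (hfree : ∀ j, f (Sum.inr j) = (c j, z)) :
    GroupForce H S y f u v := by
  induction hc generalizing u v f with
  | @captured c g i hi =>
    rcases hz with hz | hz
    · exact .captured (Sum.inr i) ((hfree i).trans (Prod.ext (hi.trans hg.symm) hz))
    · obtain ⟨i, hi⟩ := hy _ hz
      exact .captured_group i (Sum.inl i) (hsh i) hi
  | @surround c g c' hcc' hw =>
    refine .of_step fun huv => ?_
    rcases hz with hz | hz
    · refine .surround y (Sum.elim (fun i => (v.1, y i)) (fun j => (c' j, z))) (fun i => .refl _)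
        ?_ fun x hx => ?_
      · rintro (i | j)
        · rw [hsh]
          exact step_strongProd.2 ⟨huv, .refl _⟩
        · rw [hfree]
          exact step_strongProd.2 ⟨hcc' j, .refl _⟩
      · rcases hx with ⟨h1, h2⟩ | ⟨h1, h2⟩ | ⟨h1, h2⟩
        · obtain ⟨j, hj⟩ := hw x.1 (hg ▸ h1)
          exact Or.inr ⟨Sum.inr j, Prod.ext hj (hz.trans h2)⟩
        · obtain ⟨i, hi⟩ := hy x.2 (hz ▸ h2)
          exact Or.inr ⟨Sum.inl i, Prod.ext h1 hi⟩
        · exact Or.inl ⟨h1, hy x.2 (hz ▸ h2)⟩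
    · obtain ⟨i, hi⟩ := hy _ hz
      exact .captured_group i (Sum.inl i) (hsh i) hi
  | @move c g c' hcc' _ ih =>
    refine .of_step fun huv => ?_
    rcases hz with hz | hz
    · refine .move y (Sum.elim (fun i => (v.1, y i)) (fun j => (c' j, z))) (fun i => .refl _)
        ?_ fun v' h1 h2 => ?_
      · rintro (i | j)
        · rw [hsh]
          exact step_strongProd.2 ⟨huv, .refl _⟩
        · rw [hfree]
          exact step_strongProd.2 ⟨hcc' j, .refl _⟩
      · exact ih v'.1 (hg ▸ h1) rfl (hz ▸ h2) (fun _ => rfl) (fun _ => rfl)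
    · obtain ⟨i, hi⟩ := hy _ hz
      exact .captured_group i (Sum.inl i) (hsh i) hi

/-- The fence holds while the free cops walk to their starting places in the layer of `z`. -/
theorem groupForce_trapped [Finite τ] (hG : G.Connected) (hH : H.Connected) {c : τ → V}
    (hc : ∀ g, CopsForce G c g) {z : W} (hy : ∀ w, H.Adj z w → ∃ i, y i = w) (hz : Step H z v.2)
    (hsh : ∀ i, f (Sum.inl i) = (u, y i)) : GroupForce H S y f u v := by
  obtain ⟨n, hn⟩ := exists_forall_le fun j => G.dist (f (Sum.inr j)).1 (c j)
  obtain ⟨m, hm⟩ := exists_forall_le fun j => H.dist (f (Sum.inr j)).2 z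
  replace hn : ∀ j, G.dist (f (Sum.inr j)).1 (c j) ≤ n + m := fun j => (hn j).trans (by omega)
  replace hm : ∀ j, H.dist (f (Sum.inr j)).2 z ≤ n + m := fun j => (hm j).trans (by omega)
  generalize n + m = N at hn hm
  induction N generalizing u v f with
  | zero =>
    refine groupForce_trapped_game hy (hc v.1) rfl hz hsh fun j => Prod.ext ?_ ?_
    · exact hG.dist_eq_zero_iff.1 (Nat.le_zero.1 (hn j))
    · exact hH.dist_eq_zero_iff.1 (Nat.le_zero.1 (hm j))
  | succ N ih =>
    refine .of_step fun huv => ?_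
    rcases hz with hz | hz
    · choose p hp hpd using fun j => exists_step_dist_le hG (hn j)
      choose q hq hqd using fun j => exists_step_dist_le hH (hm j)
      refine .move y (Sum.elim (fun i => (v.1, y i)) (fun j => (p j, q j))) (fun i => .refl _)
        ?_ fun v' _ h2 => ih (hz ▸ h2) (fun _ => rfl) hpd hqd
      rintro (i | j)
      · rw [hsh]
        exact step_strongProd.2 ⟨huv, .refl _⟩
      · exact step_strongProd.2 ⟨hp j, hq j⟩
    · obtain ⟨i, hi⟩ := hy _ hz
      exact .captured_group i (Sum.inl i) (hsh i) hi

end Trapped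

section Layer

/-! Each group has a cop who shadows the first coordinate of the robber. -/

variable {f : κ ⊕ τ → V × W}

/-- Each group with its shadow moves as one cop of the game on `H`; a surround there is the fence
needed by `groupForce_trapped`. -/
theorem groupForce_layer_game [Finite τ] (hG : G.Connected) (hH : H.Connected) {c : τ → V}
    (hc : ∀ g, CopsForce G c g) {w : W} (hy : CopsForce H y w) (hw : v.2 = w)
    (hsh : ∀ i, f (Sum.inl i) = (u, y i)) : GroupForce H S y f u v := by
  have hstep : ∀ {y y' : κ → W} {f : κ ⊕ τ → V × W} {u : V} {v : V × W}, Step G u v.1 →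
      (∀ i, Step H (y i) (y' i)) → (∀ i, f (Sum.inl i) = (u, y i)) → ∀ i, Step (strongProd G H)
        (f i) ((Sum.elim (fun i => (v.1, y' i)) (fun j => f (Sum.inr j)) : κ ⊕ τ → V × W) i) := by
    rintro y y' f u v huv hyy hsh (i | j)
    · rw [hsh]
      exact step_strongProd.2 ⟨huv, hyy i⟩
    · exact .refl _
  induction hy generalizing u v f with
  | @captured y w i hi => exact .captured_group i (Sum.inl i) (hsh i) (hi.trans hw.symm)
  | @surround y w y' hyy' hsur =>
    refine .of_step fun huv => .move y' _ hyy' (hstep huv hyy' hsh) fun v' _ h2 => ?_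
    exact groupForce_trapped hG hH hc hsur (hw ▸ h2) (fun _ => rfl)
  | @move y w y' hyy' _ ih =>
    refine .of_step fun huv => .move y' _ hyy' (hstep huv hyy' hsh) fun v' _ h2 => ?_
    exact ih v'.2 (hw ▸ h2) rfl (fun _ => rfl)

theorem groupForce_of_shadows [Finite κ] [Finite τ] (hG : G.Connected) (hH : H.Connected)
    {c : τ → V} (hc : ∀ g, CopsForce G c g) {d : κ → W} (hd : ∀ w, CopsForce H d w)
    (hsh : ∀ i, Step G (f (Sum.inl i)).1 v.1) : GroupForce H S y f u v := by
  obtain ⟨n, hn⟩ := exists_forall_le fun i => H.dist (y i) (d i)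
  obtain ⟨m, hm⟩ := exists_forall_le fun i => H.dist (f (Sum.inl i)).2 (d i)
  -- The `+ 1` guarantees at least one move, by which the shadows, only within a step so far, get
  -- exactly onto the robber's first coordinate.
  replace hn : ∀ i, H.dist (y i) (d i) ≤ n + m + 1 := fun j => (hn j).trans (by omega)
  replace hm : ∀ i, H.dist (f (Sum.inl i)).2 (d i) ≤ n + m + 1 := fun j => (hm j).trans (by omega)
  generalize n + m = N at hn hm
  induction N generalizing u v f y with
  | zero =>
    choose p hp hpd using fun j => exists_step_dist_le hH (hn j)
    choose q hq hqd using fun j => exists_step_dist_le hH (hm j)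
    have hp' : p = d := funext fun i => hH.dist_eq_zero_iff.1 (Nat.le_zero.1 (hpd i))
    have hq' : q = d := funext fun i => hH.dist_eq_zero_iff.1 (Nat.le_zero.1 (hqd i))
    subst hp' hq'
    refine .move q (Sum.elim (fun i => (v.1, q i)) (fun j => f (Sum.inr j))) hp ?_ fun v' _ _ =>
      groupForce_layer_game hG hH hc (hd v'.2) rfl fun _ => rfl
    rintro (i | j)
    · exact step_strongProd.2 ⟨hsh i, hq i⟩
    · exact .refl _
  | succ N ih =>
    choose p hp hpd using fun j => exists_step_dist_le hH (hn j)
    choose q hq hqd using fun j => exists_step_dist_le hH (hm j)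
    refine .move p (Sum.elim (fun i => (v.1, q i)) (fun j => f (Sum.inr j))) hp ?_ fun v' h1 _ =>
      ih (fun _ => h1) hpd hqd
    rintro (i | j)
    · exact step_strongProd.2 ⟨hsh i, hq i⟩
    · exact .refl _

end Layer

section Shadows

/-! Capturing the shadow of the robber in the first factor. -/

theorem exists_shadow_move (A : Finset τ) (hA : ∀ i ∈ A, Step G (f i).1 v.1) {μ : Type*} (e : μ ↪ τ)
    (he : ∀ j, e j ∉ A) {c : μ → V} (hc : ∀ j, Step G (f (e j)).1 (c j)) :
    ∃ f' : τ → V × W, (∀ i, Step (strongProd G H) (f i) (f' i)) ∧ (∀ i ∈ A, (f' i).1 = v.1) ∧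
      ∀ j, (f' (e j)).1 = c j := by
  have : ∀ i, ∃ p : V × W, Step (strongProd G H) (f i) p ∧ (i ∈ A → p.1 = v.1) ∧
      ∀ j, e j = i → p.1 = c j := by
    intro i
    by_cases hi : i ∈ A
    · exact ⟨(v.1, (f i).2), step_strongProd.2 ⟨hA i hi, .refl _⟩, fun _ => rfl,
        fun j hj => absurd (hj ▸ hi) (he j)⟩
    · by_cases hj : ∃ j, e j = i
      · obtain ⟨j, rfl⟩ := hj
        exact ⟨(c j, (f (e j)).2), step_strongProd.2 ⟨hc j, .refl _⟩, fun h => absurd h hi,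
          fun j' hj' => by rw [e.injective hj']⟩
      · exact ⟨f i, .refl _, fun h => absurd h hi, fun j hj' => absurd ⟨j, hj'⟩ hj⟩
  choose f' h1 h2 h3 using this
  exact ⟨f', h1, h2, fun j => h3 _ j rfl⟩

variable {μ : Type*} {A : Finset τ} {e : μ ↪ τ}

theorem groupForce_shadow_game [Nontrivial V] [DecidableEq τ] (hG : G.Connected)
    (he : ∀ j, e j ∉ A)
    (hnext : ∀ f u v j, (∀ i ∈ insert (e j) A, Step G (f i).1 v.1) → GroupForce H S y f u v)
    {c : μ → V} {g : V} (hc : CopsForce G c g) (hg : v.1 = g)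
    (hA : ∀ i ∈ A, Step G (f i).1 v.1) (hf : ∀ j, (f (e j)).1 = c j) :
    GroupForce H S y f u v := by
  induction hc generalizing u v f with
  | @captured c g i hi =>
    refine hnext f u v i fun l hl => ?_
    rcases Finset.mem_insert.1 hl with rfl | hl
    · exact Or.inl ((hf i).trans (hi.trans hg.symm))
    · exact hA l hl
  | @surround c g c' hcc' hw =>
    obtain ⟨f', h1, h2, h3⟩ := exists_shadow_move (H := H) A hA e he fun j => (hf j).symm ▸ hcc' j
    refine .move y f' (fun _ => .refl _) h1 fun v' hv' _ => ?_
    -- A shadow need only be within one step. If the robber keeps his first coordinate, a cop on any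
    -- neighbour of it will do, and nontriviality provides a neighbour.
    have : ∃ x, G.Adj g x ∧ Step G x v'.1 := by
      rcases hv' with hv' | hv'
      · obtain ⟨x, hx⟩ := exists_adj_of_connected hG g
        exact ⟨x, hx, Or.inr (hv' ▸ hg ▸ hx.symm)⟩
      · exact ⟨v'.1, hg ▸ hv', .refl _⟩
    obtain ⟨x, hx, hxv⟩ := this
    obtain ⟨j, hj⟩ := hw x hx
    refine hnext f' v.1 v' j fun l hl => ?_
    rcases Finset.mem_insert.1 hl with rfl | hl
    · rwa [h3, hj]
    · rwa [h2 l hl]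
  | @move c g c' hcc' _ ih =>
    obtain ⟨f', h1, h2, h3⟩ := exists_shadow_move (H := H) A hA e he fun j => (hf j).symm ▸ hcc' j
    refine .move y f' (fun _ => .refl _) h1 fun v' hv' _ => ?_
    exact ih v'.1 (hg ▸ hv') rfl (fun i hi => (h2 i hi).symm ▸ hv') h3

theorem groupForce_add_shadow [Nontrivial V] [Finite μ] [DecidableEq τ] (hG : G.Connected)
    (he : ∀ j, e j ∉ A)
    (hnext : ∀ f u v j, (∀ i ∈ insert (e j) A, Step G (f i).1 v.1) → GroupForce H S y f u v)
    {c : μ → V} (hc : ∀ g, CopsForce G c g) (hA : ∀ i ∈ A, Step G (f i).1 v.1) :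
    GroupForce H S y f u v := by
  obtain ⟨n, hn⟩ := exists_forall_le fun j => G.dist (f (e j)).1 (c j)
  induction n generalizing u v f with
  | zero => exact groupForce_shadow_game hG he hnext (hc v.1) rfl hA fun j =>
      hG.dist_eq_zero_iff.1 (Nat.le_zero.1 (hn j))
  | succ n ih =>
    choose p hp hpd using fun j => exists_step_dist_le hG (hn j)
    obtain ⟨f', h1, h2, h3⟩ := exists_shadow_move (H := H) A hA e he hp
    exact .move y f' (fun _ => .refl _) h1 fun v' hv' _ =>
      ih (fun i hi => (h2 i hi).symm ▸ hv') fun j => (h3 j).symm ▸ hpd j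

end Shadows

/-- The shadows may be any of the free cops; this relabelling moves them to the left summand, one
for each group. -/
theorem exists_perm_image_inl [Fintype κ] [Fintype μ] {A : Finset (κ ⊕ μ)}
    (hA : A.card = Fintype.card κ) : ∃ e : Equiv.Perm (κ ⊕ μ), ∀ i, e (Sum.inl i) ∈ A := by
  classical
  have e1 : κ ≃ A := Fintype.equivOfCardEq (by simp [hA])
  obtain ⟨g, hg⟩ := Finset.exists_equiv_extend_of_card_eq (α := κ ⊕ μ) (t := Finset.univ)
    (by simp) (s := Finset.univ.map ⟨Sum.inl, Sum.inl_injective⟩)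
    (f := Sum.elim (fun i => (e1 i : κ ⊕ μ)) Sum.inr) (by simp) (by
      intro i hi j hj hij
      simp only [Finset.coe_map, Function.Embedding.coeFn_mk, Finset.coe_univ, Set.image_univ,
        Set.mem_range] at hi hj
      obtain ⟨i, rfl⟩ := hi
      obtain ⟨j, rfl⟩ := hj
      simpa [Subtype.ext_iff] using hij)
  refine ⟨g.trans (Equiv.subtypeUnivEquiv Finset.mem_univ), fun i => ?_⟩
  have := hg (Sum.inl i) (by simp)
  simp [this]

theorem groupForce [Fintype κ] [Fintype τ] (hG : G.Connected) (hH : H.Connected)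
    {c : τ → V} (hc : ∀ g, CopsForce G c g) {d : κ → W} (hd : ∀ w, CopsForce H d w)
    (f : κ ⊕ τ → V × W) (u : V) (v : V × W) : GroupForce H S y f u v := by
  classical
  -- On a one-vertex graph `τ` may be empty, but there every cop is a shadow already.
  rcases subsingleton_or_nontrivial V with hV | hV
  · exact groupForce_of_shadows hG hH hc hd fun _ => Or.inl (Subsingleton.elim _ _)
  suffices key : ∀ n (A : Finset (κ ⊕ τ)), A.card + n = Fintype.card κ → ∀ f u v,
      (∀ i ∈ A, Step G (f i).1 v.1) → GroupForce H S y f u v from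
    key (Fintype.card κ) ∅ (by simp) f u v (by simp)
  intro n
  induction n with
  | zero =>
    intro A hA f u v hf
    obtain ⟨e, he⟩ := exists_perm_image_inl hA
    exact .reindex e (groupForce_of_shadows hG hH hc hd fun i => hf _ (he i))
  | succ n ih =>
    intro A hA f u v hf
    -- While fewer than `|κ|` of the `|κ| + |τ|` free cops are shadows, at least `|τ|` remain to win
    -- another one.
    have hcard : Fintype.card τ ≤ Fintype.card {i // i ∉ A} := by
      rw [Fintype.card_subtype_compl, Fintype.card_coe, Fintype.card_sum]
      omega
    obtain ⟨e⟩ := Function.Embedding.nonempty_of_card_le hcard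
    refine groupForce_add_shadow (e := e.trans (Function.Embedding.subtype _)) hG
      (fun j => (e j).2) (fun f u v j hj => ih _ ?_ f u v hj) hc hf
    have := Finset.card_insert_of_notMem (e j).2
    change (insert (e j : κ ⊕ τ) A).card + n = _
    omega

theorem surroundingNumber_strongProd_le [Finite V] [Finite W] (hG : G.Connected)
    (hH : H.Connected) : surroundingNumber (strongProd G H) ≤
      surroundingNumber H * (bodyguardNumber G + 1) + surroundingNumber G := by
  obtain ⟨S, hS⟩ := bodyguardsWin_bodyguardNumber G
  obtain ⟨c, hc⟩ := surroundingCopsWin_iff.1 (surroundingCopsWin_surroundingNumber G)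
  obtain ⟨d, hd⟩ := surroundingCopsWin_iff.1 (surroundingCopsWin_surroundingNumber H)
  have key := bodyguard_induction hS (Q := fun h => ∀ (y : Fin (surroundingNumber H) → W)
    (f : Fin (surroundingNumber H) ⊕ Fin (surroundingNumber G) → V × W) (w : V × W),
      (∀ u ∈ h.head?, Step G u w.1) → CopsForce (strongProd G H) (config S h y f) w) ?_
  · obtain ⟨g⟩ := hG.nonempty
    obtain ⟨z⟩ := hH.nonempty
    have hcard : Fintype.card ((Fin (surroundingNumber H) × Fin (bodyguardNumber G)) ⊕
        Fin (surroundingNumber H) ⊕ Fin (surroundingNumber G)) =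
          surroundingNumber H * (bodyguardNumber G + 1) + surroundingNumber G := by
      simp only [Fintype.card_sum, Fintype.card_prod, Fintype.card_fin]
      ring
    refine surroundingNumber_le_of_copsForce hcard
      (config S [] (fun _ => z) (fun _ => (g, z))) fun v => ?_
    -- An idle turn of the free cops and the layers makes the bodyguards' history nonempty.
    refine .move _ (config_step S [] v.1 (fun _ => .refl _) (fun _ => .refl _)) fun v' hv' => ?_
    exact key [v.1] ⟨List.cons_ne_nil _ _, List.isChain_singleton _⟩ _ _ _
      (by simpa using (step_strongProd.1 hv').1)
  · intro h hh hlater y f w hw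
    have hset : Settled H (Fin (surroundingNumber H))
        (Fin (surroundingNumber H) ⊕ Fin (surroundingNumber G)) S h := fun v h' h1 h2 =>
      (hlater v h' h1 h2).imp_right fun hq y f w hw => hq y f w fun u hu => Option.some.inj hu ▸ hw
    have hh' : IsHistory G (w.1 :: h) := by
      cases h with
      | nil => exact absurd rfl hh.1
      | cons u h => exact hh.cons (hw u (by simp))
    -- `GroupForce` begins just after the bodyguards have surrounded the first coordinate, so they
    -- answer `w.1` here.
    refine .move _ (config_step S h w.1 (fun _ => .refl _) (fun _ => .refl _)) fun w' hw' => ?_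
    have hstep := (step_strongProd.1 hw').1
    rcases hset w.1 h (List.suffix_refl _) hh' with hs | hwin
    · exact groupForce hG hH hc hd _ _ _ hstep _ (hset.mono (List.suffix_cons _ _)) hh' hs
    · exact hwin _ _ _ hstep

theorem strongProdComm (G : SimpleGraph V) (H : SimpleGraph W) :
    Nonempty (strongProd G H ≃g strongProd H G) :=
  ⟨⟨Equiv.prodComm V W, by
    intro a b
    simp only [strongProd, Equiv.prodComm_apply, Prod.fst_swap, Prod.snd_swap]
    tauto⟩⟩

theorem surroundingNumber_strongProd_le_min [Finite V] [Finite W] (hG : G.Connected)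
    (hH : H.Connected) : surroundingNumber (strongProd G H) ≤
      min (surroundingNumber H * (bodyguardNumber G + 1) + surroundingNumber G)
        (surroundingNumber G * (bodyguardNumber H + 1) + surroundingNumber H) := by
  obtain ⟨φ⟩ := strongProdComm H G
  exact le_min (surroundingNumber_strongProd_le hG hH)
    ((surroundingNumber_le_of_iso φ).trans (surroundingNumber_strongProd_le hH hG))

end Product

/-! ### Sharpness for products of cycles. -/

section Cycle

variable {V W : Type*} {G : SimpleGraph V} {H : SimpleGraph W}

/-- Closed neighbourhoods in the strong product are products of closed neighbourhoods. -/
theorem MinDegreeGE.strongProd {a b : ℕ} (hG : MinDegreeGE G a) (hH : MinDegreeGE H b) :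
    MinDegreeGE (strongProd G H) ((a + 1) * (b + 1) - 1) := by
  rintro ⟨v, w⟩
  obtain ⟨M, hM, hvM, hsM⟩ := hG v
  obtain ⟨N, hN, hwN, hsN⟩ := hH w
  refine ⟨M ×ˢ N, ?_, Finset.mem_product.2 ⟨hvM, hwN⟩, fun x hx => ?_⟩
  · rw [Finset.card_product, Nat.sub_add_cancel (Nat.mul_pos a.succ_pos b.succ_pos)]
    exact Nat.mul_le_mul hM hN
  · obtain ⟨h1, h2⟩ := Finset.mem_product.1 hx
    exact step_strongProd.2 ⟨hsM _ h1, hsN _ h2⟩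

/-- If the bodyguards can surround the president on their first turn, and whenever they surround
him, they can follow him, then they win. -/
theorem bodyguardsWin_of_follow {k : ℕ} (c : Fin k → V)
    (hstart : ∀ v, ∃ c', (∀ i, Step G (c i) (c' i)) ∧ Surrounded G c' v)
    (hfollow : ∀ (c : Fin k → V) v v', Surrounded G c v → Step G v v' →
      ∃ c', (∀ i, Step G (c i) (c' i)) ∧ Surrounded G c' v') : BodyguardsWin G k := by
  have hresp : ∀ (c : Fin k → V) v, ∃ c', (∀ i, Step G (c i) (c' i)) ∧
      ((∃ c', (∀ i, Step G (c i) (c' i)) ∧ Surrounded G c' v) → Surrounded G c' v) := by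
    intro c v
    by_cases h : ∃ c', (∀ i, Step G (c i) (c' i)) ∧ Surrounded G c' v
    · obtain ⟨c', h1, h2⟩ := h
      exact ⟨c', h1, fun _ => h2⟩
    · exact ⟨c, fun _ => .refl _, fun h' => absurd h' h⟩
  choose ρ hρ hsur using hresp
  let pos : List V → Fin k → V := fun h => List.rec c (fun v _ d => ρ d v) h
  refine ⟨⟨pos, fun h v i => hρ (pos h) v i⟩, fun p hp => ⟨0, fun t _ => ?_⟩⟩
  induction t with
  | zero => exact hsur _ _ (hstart _)
  | succ t ih => exact hsur _ _ (hfollow _ _ _ (ih (Nat.zero_le _)) (hp t))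

variable {n : ℕ}

theorem cycleGraph_adj_iff {u v : Fin (n + 3)} :
    (SimpleGraph.cycleGraph (n + 3)).Adj u v ↔ v = u + 1 ∨ v = u - 1 := by
  rw [SimpleGraph.cycleGraph_adj, or_comm, sub_eq_iff_eq_add', sub_eq_iff_eq_add', eq_sub_iff_add_eq,
    eq_comm (b := u)]

theorem surrounded_cycleGraph_iff {k : ℕ} {c : Fin k → Fin (n + 3)} {v : Fin (n + 3)} :
    Surrounded (SimpleGraph.cycleGraph (n + 3)) c v ↔ Occupied c (v + 1) ∧ Occupied c (v - 1) := by
  simp [Surrounded, cycleGraph_adj_iff]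

theorem minDegreeGE_cycleGraph : MinDegreeGE (SimpleGraph.cycleGraph (n + 3)) 2 := by
  intro v
  have h1 : (1 : Fin (n + 3)) ≠ 0 := by simp
  have h2 : (1 : Fin (n + 3)) + 1 ≠ 0 := by
    rw [Ne, Fin.ext_iff, Fin.val_add]
    simp [Nat.mod_eq_of_lt]
  refine ⟨{v, v + 1, v - 1}, le_of_eq ?_, by simp, fun w hw => ?_⟩
  · rw [Finset.card_eq_three.2 ⟨v, v + 1, v - 1, ?_, ?_, ?_, rfl⟩]
    · rwa [Ne, left_eq_add]
    · rwa [Ne, eq_sub_iff_add_eq, add_eq_left]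
    · rwa [Ne, eq_sub_iff_add_eq, add_assoc, add_eq_left]
  · simp only [Finset.mem_insert, Finset.mem_singleton] at hw
    exact hw.imp Eq.symm cycleGraph_adj_iff.2

open scoped Fin.CommRing in
theorem surroundingNumber_cycleGraph : surroundingNumber (SimpleGraph.cycleGraph (n + 3)) = 2 := by
  refine le_antisymm ?_ minDegreeGE_cycleGraph.le_surroundingNumber
  -- The cycle is unrolled to `ℕ`: the robber stays in the interval between the two cops, and its
  -- length drops each turn.
  have key : ∀ d i j x : ℕ, j - i ≤ d → i ≤ x → x ≤ j →
      CopsForce (SimpleGraph.cycleGraph (n + 3)) ![(i : Fin (n + 3)), (j : Fin (n + 3))] x := by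
    intro d
    induction d with
    | zero =>
      intro i j x hd hi hj
      exact .captured 0 (by rw [show x = i by omega]; rfl)
    | succ d ih =>
      intro i j x hd hi hj
      rcases hi.eq_or_lt with rfl | hi
      · exact .captured 0 rfl
      rcases hj.eq_or_lt with rfl | hj
      · exact .captured 1 rfl
      obtain ⟨x, rfl⟩ : ∃ y, x = y + 1 := ⟨x - 1, by omega⟩
      by_cases hij : x = i ∧ j = x + 2
      · obtain ⟨rfl, rfl⟩ := hij
        refine .surround _ (fun _ => .refl _) fun w hw => ?_
        rcases cycleGraph_adj_iff.1 hw with rfl | rfl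
        · exact ⟨1, by simp [add_assoc, one_add_one_eq_two]⟩
        · exact ⟨0, by simp⟩
      -- A cop advances unless he is next to the robber, so no reply leaves the interval; not both
      -- cops are next to him, so it shrinks.
      · obtain ⟨i', hi1, hi2⟩ : ∃ i', (i' = i ∧ x = i ∨ i' = i + 1 ∧ i < x) ∧
            Step (SimpleGraph.cycleGraph (n + 3)) (i : Fin (n + 3)) (i' : Fin (n + 3)) := by
          rcases (Nat.lt_succ_iff.1 hi).eq_or_lt with rfl | hi
          · exact ⟨i, Or.inl ⟨rfl, rfl⟩, .refl _⟩
          · exact ⟨i + 1, Or.inr ⟨rfl, hi⟩, Or.inr (cycleGraph_adj_iff.2 (Or.inl (by simp)))⟩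
        obtain ⟨j', hj1, hj2⟩ : ∃ j', (j' = j ∧ j = x + 2 ∨ j' + 1 = j ∧ x + 2 < j) ∧
            Step (SimpleGraph.cycleGraph (n + 3)) (j : Fin (n + 3)) (j' : Fin (n + 3)) := by
          rcases (Nat.succ_le_iff.2 hj).eq_or_lt with rfl | hj
          · exact ⟨_, Or.inl ⟨rfl, rfl⟩, .refl _⟩
          · obtain ⟨j, rfl⟩ : ∃ l, j = l + 1 := ⟨j - 1, by omega⟩
            exact ⟨j, Or.inr ⟨rfl, hj⟩, Or.inr (cycleGraph_adj_iff.2 (Or.inr (by simp)))⟩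
        refine .move ![(i' : Fin (n + 3)), (j' : Fin (n + 3))] ?_ fun v' hv' => ?_
        · intro l
          fin_cases l
          · exact hi2
          · exact hj2
        · rcases hv' with rfl | hv'
          · exact ih i' j' (x + 1) (by omega) (by omega) (by omega)
          · rcases cycleGraph_adj_iff.1 hv' with rfl | rfl
            · exact_mod_cast ih i' j' (x + 1 + 1) (by omega) (by omega) (by omega)
            · simpa using ih i' j' x (by omega) (by omega) (by omega)
  -- Both cops start at vertex `0`, lifted to `0` and `n + 3`, so the interval covers the whole
  -- cycle.
  refine surroundingNumber_le_of_copsForce (Fintype.card_fin 2)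
    ![((0 : ℕ) : Fin (n + 3)), ((n + 3 : ℕ) : Fin (n + 3))] fun v => ?_
  simpa using key _ 0 (n + 3) v le_rfl (Nat.zero_le _) v.2.le

theorem bodyguardsWin_cycleGraph (hn : n ≤ 2) :
    BodyguardsWin (SimpleGraph.cycleGraph (n + 3)) 2 := by
  have hadd : ∀ {u v v' : Fin (n + 3)}, Step (SimpleGraph.cycleGraph (n + 3)) v v' →
      Step (SimpleGraph.cycleGraph (n + 3)) u (u + (v' - v)) := by
    rintro u v v' (rfl | h)
    · exact Or.inl (by simp)
    · rcases cycleGraph_adj_iff.1 h with rfl | rfl <;>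
        exact Or.inr (cycleGraph_adj_iff.2 (by simp [sub_eq_add_neg]))
  -- For lengths 3, 4 and 5, the bodyguards at `0` and `2` can reach the two neighbours of any
  -- vertex in one turn; afterwards they copy the president's translation.
  refine bodyguardsWin_of_follow ![0, 2] (fun v => ?_) fun c v v' hs hv => ?_
  · suffices h : ∃ a b : Fin (n + 3), (0 = a ∨ a = 0 + 1 ∨ a = 0 - 1) ∧
        (2 = b ∨ b = 2 + 1 ∨ b = 2 - 1) ∧ (a = v + 1 ∨ b = v + 1) ∧ (a = v - 1 ∨ b = v - 1) by
      obtain ⟨a, b, ha, hb, h1, h2⟩ := h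
      refine ⟨![a, b], fun i => ?_, surrounded_cycleGraph_iff.2
        ⟨by simpa [Occupied] using h1, by simpa [Occupied] using h2⟩⟩
      fin_cases i
      · exact ha.imp_right cycleGraph_adj_iff.2
      · exact hb.imp_right cycleGraph_adj_iff.2
    revert v
    interval_cases n <;> decide
  · obtain ⟨⟨i, hi⟩, ⟨j, hj⟩⟩ := surrounded_cycleGraph_iff.1 hs
    exact ⟨fun i => c i + (v' - v), fun i => hadd hv, surrounded_cycleGraph_iff.2
      ⟨⟨i, by simp only [hi]; abel⟩, ⟨j, by simp only [hj]; abel⟩⟩⟩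

end Cycle

end PursuitGames

theorem mainTheorem12 :
    (∀ {V : Type*} {W : Type*} [Finite V] [Finite W] (G : SimpleGraph V) (H : SimpleGraph W),
      G.Connected → H.Connected →
        PursuitGames.surroundingNumber (PursuitGames.strongProd G H) ≤
          min
            (PursuitGames.surroundingNumber H * (PursuitGames.bodyguardNumber G + 1) +
              PursuitGames.surroundingNumber G)
            (PursuitGames.surroundingNumber G * (PursuitGames.bodyguardNumber H + 1) +
              PursuitGames.surroundingNumber H)) ∧
    (∀ n m : ℕ, 3 ≤ n → n ≤ 5 → 3 ≤ m →
      PursuitGames.surroundingNumber (PursuitGames.strongProd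
          (SimpleGraph.cycleGraph n) (SimpleGraph.cycleGraph m)) =
        min
          (PursuitGames.surroundingNumber (SimpleGraph.cycleGraph m) *
              (PursuitGames.bodyguardNumber (SimpleGraph.cycleGraph n) + 1) +
            PursuitGames.surroundingNumber (SimpleGraph.cycleGraph n))
          (PursuitGames.surroundingNumber (SimpleGraph.cycleGraph n) *
              (PursuitGames.bodyguardNumber (SimpleGraph.cycleGraph m) + 1) +
            PursuitGames.surroundingNumber (SimpleGraph.cycleGraph m)) ∧
      PursuitGames.surroundingNumber (PursuitGames.strongProd
          (SimpleGraph.cycleGraph n) (SimpleGraph.cycleGraph m)) = 8) := by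
  refine ⟨fun G H hG hH => PursuitGames.surroundingNumber_strongProd_le_min hG hH,
    fun n m hn hn5 hm => ?_⟩
  obtain ⟨n, rfl⟩ := Nat.exists_eq_add_of_le' hn
  obtain ⟨m, rfl⟩ := Nat.exists_eq_add_of_le' hm
  have hlow := (PursuitGames.minDegreeGE_cycleGraph (n := n)).strongProd
    (PursuitGames.minDegreeGE_cycleGraph (n := m)) |>.le_surroundingNumber
  have hconn : ∀ l, (SimpleGraph.cycleGraph (l + 3)).Connected := fun _ =>
    SimpleGraph.cycleGraph_connected
  have hup := PursuitGames.surroundingNumber_strongProd_le_min (hconn n) (hconn m)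
  have hBn : PursuitGames.bodyguardNumber (SimpleGraph.cycleGraph (n + 3)) = 2 :=
    le_antisymm (Nat.sInf_le (PursuitGames.bodyguardsWin_cycleGraph (by omega)))
      PursuitGames.minDegreeGE_cycleGraph.le_bodyguardNumber
  -- A lower bound suffices here: it makes the second term of the minimum at least 8, while the
  -- first is 2 · 3 + 2 = 8.
  have hBm := (PursuitGames.minDegreeGE_cycleGraph (n := m)).le_bodyguardNumber
  simp only [PursuitGames.surroundingNumber_cycleGraph, hBn] at hup ⊢
  omega
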